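/- Let $L$ be an arbitrary set of labels. A labelled Markov process (LMP) with label set $L$ is a structure $(S,\Sigma,\{\tau_a : a\in L\})$ where $(S,\Sigma)$ is a measurable space and, for each $a\in L$, $\tau_a : S\times\Sigma\to[0,1]$ is such that $\tau_a(s,\cdot)$ is a measure with $\tau_a(s,S)\le 1$ for every $s\in S$, and $\tau_a(\cdot,Q)$ is $\Sigma$-measurable for every $Q\in\Sigma$. A zigzag morphism from $(S,\Sigma,\{\tau_a\})$ to $(S',\Sigma',\{\tau'_a\})$ is a surjective measurable map $f : S\to S'$ such that $\tau_a(s,f^{-1}(Q)) = \tau'_a(f(s),Q)$ for all $a\in L$, $s\in S$ and $Q\in\Sigma'$. A measurable space is a separable universally measurable space if it is isomorphic to a subset $A$ of a Polish space $Y$ with the trace of the Borel $\sigma$-algebra of $Y$, where $A$ is universally measurable, i.e. measurable with respect to the completion of every finite Borel measure on $Y$. **Theorem.** Consider the category whose objects are the LMP with label set $L$ whose state space is a separable universally measurable space, and whose morphisms are the zigzag morphisms. In this category every cospan has a semipullback: for all objects $\mathbf S_0,\mathbf S_1,\mathbf S_2$ and zigzag morphisms $h_1:\mathbf S_1\to\mathbf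 S_0$ and $h_2:\mathbf S_2\to\mathbf S_0$ there are an object $\mathbf S_3$ of the category and zigzag morphisms $k_1:\mathbf S_3\to\mathbf S_1$ and $k_2:\mathbf S_3\to\mathbf S_2$ such that $h_1\circ k_1=h_2\circ k_2$. -/

import Mathlib

open MeasureTheory ProbabilityTheory CategoryTheory

universe u v

/-- A subset `A` of a Borel space `Y` is universally measurable if it is measurable with respect to
the completion of every finite Borel measure on `Y`. -/
def IsUniversallyMeasurable {Y : Type u} [MeasurableSpace Y] (A : Set Y) : Prop :=
  ∀ μ : Measure Y, IsFiniteMeasure μ → NullMeasurableSet A μ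

/-- A measurable space is a separable universally measurable space if it is isomorphic to a
universally measurable subset of a Polish space, with the trace of the Borel σ-algebra (which is
the σ-algebra that a subtype carries). -/
def IsSeparableUniversallyMeasurableSpace (S : Type u) [MeasurableSpace S] : Prop :=
  ∃ (Y : Type u) (_ : TopologicalSpace Y) (_ : PolishSpace Y) (_ : MeasurableSpace Y)
    (_ : BorelSpace Y) (A : Set Y), IsUniversallyMeasurable A ∧ Nonempty (S ≃ᵐ A)

/-- A labelled Markov process with label set `L`: a measurable space with a subprobability kernel
from the space to itself for every label. -/
structure LMP (L : Type v) where
  /-- The state space. -/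
  State : Type u
  /-- The σ-algebra of the state space. -/
  [measurableSpace : MeasurableSpace State]
  /-- The transition kernels. -/
  τ : L → Kernel State State
  /-- Each `τ a s` is a measure bounded above by `1`. -/
  τ_le_one : ∀ (a : L) (s : State), τ a s Set.univ ≤ 1

namespace LMP

attribute [instance] LMP.measurableSpace

/-- A zigzag morphism: a surjective measurable map `f` with
`τ_a(s, f⁻¹(Q)) = τ'_a(f(s), Q)` for all labels `a`, states `s` and measurable sets `Q`. -/
@[ext]
structure Zigzag {L : Type v} (S T : LMP.{u, v} L) where
  /-- The underlying map of states. -/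
  toFun : S.State → T.State
  measurable : Measurable toFun
  surjective : Function.Surjective toFun
  zigzag : ∀ (a : L) (s : S.State) (Q : Set T.State), MeasurableSet Q →
    S.τ a s (toFun ⁻¹' Q) = T.τ a (toFun s) Q

/-- The category of LMP with label set `L` and zigzag morphisms; composition is composition of
maps. -/
instance {L : Type v} : Category (LMP.{u, v} L) where
  Hom S T := Zigzag S T
  id S :=
    { toFun := id
      measurable := measurable_id
      surjective := Function.surjective_id
      zigzag := fun _ _ _ _ => rfl }
  comp f g :=
    { toFun := g.toFun ∘ f.toFun
      measurable := g.measurable.comp f.measurable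
      surjective := g.surjective.comp f.surjective
      zigzag := fun a s Q hQ =>
        (f.zigzag a s _ (g.measurable hQ)).trans (g.zigzag a (f.toFun s) Q hQ) }

end LMP

/-- The property of an LMP that its state space is a separable universally measurable space. -/
def LMP.separableUniversallyMeasurable (L : Type v) : ObjectProperty (LMP.{u, v} L) :=
  fun S => IsSeparableUniversallyMeasurableSpace S.State

/-- The category of LMP over separable universally measurable spaces, with all zigzag morphisms
between them. -/
abbrev UnivMeasLMP (L : Type v) :=
  (LMP.separableUniversallyMeasurable.{u, v} L).FullSubcategory

/-! ### Universal embeddings. -/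

open Set

/-! The semipullback lives on the set-theoretic pullback `P` of the state maps; surjectivity of each
map makes the opposite projection onto. At `(s₁, s₂)` in `P` the two transition measures have the
same image on the common quotient, so they can be coupled conditionally independently over it
(`Kernel.exists_coupling_of_fst_eq`). The disintegration requires standard Borel fibres, so it takes
place in the ambient Polish spaces. Universal measurability makes the embedded pullback measurable
for every resulting measure, and of full measure, so the coupling restricts to `P`
(`exists_kernel_map_eq`). -/

/-- A measurable embedding up to universal measurability: an injection `e` such that the source
carries the trace of the σ-algebra of the target and the range is universally measurable. -/
structure IsUniversalEmbedding {S Y : Type u} [mS : MeasurableSpace S] [mY : MeasurableSpace Y]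
    (e : S → Y) : Prop where
  injective : Function.Injective e
  comap_eq : mY.comap e = mS
  range : IsUniversallyMeasurable (Set.range e)

/-- A finite measure pushes forward to a finite measure, and null measurability pulls back from the
pushforward. -/
theorem IsUniversallyMeasurable.preimage {X Y : Type u} [MeasurableSpace X] [MeasurableSpace Y]
    {A : Set Y} (hA : IsUniversallyMeasurable A) {f : X → Y} (hf : Measurable f) :
    IsUniversallyMeasurable (f ⁻¹' A) := fun μ _ =>
  (hA (μ.map f) inferInstance).preimage (hf.quasiMeasurePreserving μ)

theorem MeasurableEquiv.isUniversalEmbedding_subtype_val {S Y : Type u} [MeasurableSpace S]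
    [MeasurableSpace Y] {A : Set Y} (hA : IsUniversallyMeasurable A) (e : S ≃ᵐ A) :
    IsUniversalEmbedding (fun s => (e s : Y)) where
  injective := Subtype.val_injective.comp e.injective
  comap_eq := MeasurableSpace.comap_comp.symm.trans e.measurableEmbedding.comap_eq
  range := by
    have : Set.range (fun s => (e s : Y)) = A := by
      rw [Set.range_comp' Subtype.val e, e.surjective.range_eq, Set.image_univ, Subtype.range_coe]
    rwa [this]

namespace IsUniversalEmbedding

variable {S Y : Type u} [MeasurableSpace S] [MeasurableSpace Y] {e : S → Y}

theorem measurable (he : IsUniversalEmbedding e) : Measurable e := by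
  rw [measurable_iff_comap_le, he.comap_eq]

theorem exists_preimage_eq (he : IsUniversalEmbedding e) {Q : Set S} (hQ : MeasurableSet Q) :
    ∃ B : Set Y, MeasurableSet B ∧ e ⁻¹' B = Q := by
  rwa [← he.comap_eq] at hQ

theorem image (he : IsUniversalEmbedding e) {Q : Set S} (hQ : MeasurableSet Q) :
    IsUniversallyMeasurable (e '' Q) := by
  intro μ _
  obtain ⟨B, hB, rfl⟩ := he.exists_preimage_eq hQ
  rw [Set.image_preimage_eq_inter_range]
  exact hB.nullMeasurableSet.inter (he.range μ inferInstance)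

theorem comp_subtype_val (he : IsUniversalEmbedding e) {Q : Set S} (hQ : MeasurableSet Q) :
    IsUniversalEmbedding (fun s : Q => e s) where
  injective := he.injective.comp Subtype.val_injective
  comap_eq := by
    have : (‹MeasurableSpace Y›.comap e).comap (Subtype.val : Q → S) =
        ‹MeasurableSpace S›.comap Subtype.val := by rw [he.comap_eq]
    rw [MeasurableSpace.comap_comp] at this
    exact this
  range := by
    have := he.image hQ
    rwa [← Subtype.range_coe (s := Q), ← Set.range_comp] at this

theorem prodMap {T Z : Type u} [MeasurableSpace T] [MeasurableSpace Z] {g : T → Z}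
    (he : IsUniversalEmbedding e) (hg : IsUniversalEmbedding g) :
    IsUniversalEmbedding (Prod.map e g) where
  injective := he.injective.prodMap hg.injective
  comap_eq := by
    change MeasurableSpace.comap _ (MeasurableSpace.comap _ _ ⊔ MeasurableSpace.comap _ _) =
      MeasurableSpace.comap _ _ ⊔ MeasurableSpace.comap _ _
    rw [MeasurableSpace.comap_sup, MeasurableSpace.comap_comp, MeasurableSpace.comap_comp,
      ← he.comap_eq, ← hg.comap_eq, MeasurableSpace.comap_comp, MeasurableSpace.comap_comp]
    rfl
  range := by
    intro μ _
    rw [Set.range_prodMap, Set.prod_eq]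
    exact (he.range.preimage measurable_fst μ inferInstance).inter
      (hg.range.preimage measurable_snd μ inferInstance)

theorem id : IsUniversalEmbedding (_root_.id : S → S) where
  injective := Function.injective_id
  comap_eq := MeasurableSpace.comap_id
  range := by
    intro μ _
    rw [Set.range_id]
    exact nullMeasurableSet_univ

theorem map_compl_range (he : IsUniversalEmbedding e) (μ : Measure S) [IsFiniteMeasure μ] :
    μ.map e (Set.range e)ᶜ = 0 := by
  rw [Measure.map_apply₀ he.measurable.aemeasurable (he.range _ inferInstance).compl]
  simp [Set.preimage_compl]

/-- A measurable map into a space with measurable diagonal, paired with a universal embedding. -/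
theorem prodMk {Z : Type u} [MeasurableSpace Z] [MeasurableEq Z] (he : IsUniversalEmbedding e)
    {f : S → Z} (hf : Measurable f) : IsUniversalEmbedding (fun s => (f s, e s)) where
  injective := fun _ _ h => he.injective (Prod.ext_iff.1 h).2
  comap_eq := by
    refine le_antisymm (hf.prodMk he.measurable).comap_le ?_
    intro Q hQ
    obtain ⟨B, hB, rfl⟩ := he.exists_preimage_eq hQ
    exact ⟨Prod.snd ⁻¹' B, measurable_snd hB, rfl⟩
  range := by
    -- The range is the image under `id × e` of the graph of `f`, which is measurable because `Z`
    -- has a measurable diagonal.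
    have h := ((id (S := Z)).prodMap he).image
      (measurableSet_eq_fun measurable_fst (hf.comp measurable_snd))
    convert h using 1
    ext ⟨z, y⟩
    constructor
    · rintro ⟨s, hs⟩
      exact ⟨(f s, s), rfl, hs⟩
    · rintro ⟨⟨z', s⟩, rfl : z' = f s, hs⟩
      exact ⟨s, hs⟩

/-- A finite kernel into the target whose values are concentrated on the range lifts to the
source. -/
theorem exists_kernel_map_eq {α : Type*} [MeasurableSpace α] (he : IsUniversalEmbedding e)
    (κ : Kernel α Y) [IsFiniteKernel κ] (hκ : ∀ a, κ a (Set.range e)ᶜ = 0) :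
    ∃ η : Kernel α S, η.map e = κ := by
  -- Measurable sets of `S` are exactly the preimages of measurable `B`, so this identity gives both
  -- measurability in `a` and the pushforward.
  have key : ∀ a (B : Set Y), MeasurableSet B → (κ a).comap e (e ⁻¹' B) = κ a B := by
    intro a B hB
    rw [Measure.comap_apply₀ e _ he.injective (fun s hs => he.image hs _ inferInstance)
      (he.measurable hB).nullMeasurableSet, Set.image_preimage_eq_inter_range]
    exact measure_inter_conull (hκ a)
  refine ⟨⟨fun a => (κ a).comap e, ?_⟩, ?_⟩
  · refine Measure.measurable_of_measurable_coe _ fun Q hQ => ?_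
    obtain ⟨B, hB, rfl⟩ := he.exists_preimage_eq hQ
    simp_rw [key _ B hB]
    exact κ.measurable_coe hB
  · ext a B hB
    rw [Kernel.map_apply' _ he.measurable _ hB]
    exact key a B hB

end IsUniversalEmbedding

/-! ### Couplings over a common quotient. -/

/-- Two finite kernels with the same first marginal have a coupling that is conditionally
independent over that marginal. -/
theorem ProbabilityTheory.Kernel.exists_coupling_of_fst_eq {α Z Y₁ Y₂ : Type*} [MeasurableSpace α]
    [MeasurableSpace Z] [MeasurableSpace.CountablyGenerated Z]
    [MeasurableSpace Y₁] [StandardBorelSpace Y₁] [Nonempty Y₁]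
    [MeasurableSpace Y₂] [StandardBorelSpace Y₂] [Nonempty Y₂]
    (κ₁ : Kernel α (Z × Y₁)) (κ₂ : Kernel α (Z × Y₂)) [IsFiniteKernel κ₁] [IsFiniteKernel κ₂]
    (h : κ₁.fst = κ₂.fst) :
    ∃ κ : Kernel α (Z × Y₁ × Y₂), IsFiniteKernel κ ∧
      κ.map (fun p => (p.1, p.2.1)) = κ₁ ∧ κ.map (fun p => (p.1, p.2.2)) = κ₂ := by
  refine ⟨κ₁.fst ⊗ₖ (κ₁.condKernel ×ₖ κ₂.condKernel), inferInstance, ?_, ?_⟩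
  · conv_rhs => rw [← κ₁.disintegrate κ₁.condKernel]
    ext a s hs
    have hm : Measurable (fun p : Z × Y₁ × Y₂ => (p.1, p.2.1)) := by fun_prop
    rw [map_apply' _ hm _ hs, compProd_apply (hm hs), compProd_apply hs]
    refine lintegral_congr fun z => ?_
    conv_rhs => rw [← fst_prod κ₁.condKernel κ₂.condKernel]
    rw [fst_apply' _ _ (measurable_prodMk_left hs)]
    rfl
  · conv_rhs => rw [← κ₂.disintegrate κ₂.condKernel, ← h]
    ext a s hs
    have hm : Measurable (fun p : Z × Y₁ × Y₂ => (p.1, p.2.2)) := by fun_prop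
    rw [map_apply' _ hm _ hs, compProd_apply (hm hs), compProd_apply hs]
    refine lintegral_congr fun z => ?_
    conv_rhs => rw [← snd_prod κ₁.condKernel κ₂.condKernel]
    rw [snd_apply' _ _ (measurable_prodMk_left hs)]
    rfl

theorem MeasurableEq.of_measurable_injective {S Y : Type*} [MeasurableSpace S]
    [MeasurableSpace Y] [MeasurableEq Y] {e : S → Y} (he : Measurable e)
    (hinj : Function.Injective e) : MeasurableEq S where
  measurableSet_diagonal := by
    have := measurableSet_eq_fun (he.comp (measurable_fst (α := S) (β := S)))
      (he.comp measurable_snd)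
    convert this using 1
    ext ⟨x, y⟩
    exact hinj.eq_iff.symm

/-- Kernels on two spaces that agree after projection to a common quotient have a joint lift to the
pullback. -/
theorem exists_kernel_pullback {S₀ S₁ S₂ Y₁ Y₂ : Type u}
    [MeasurableSpace S₀] [MeasurableSpace S₁] [MeasurableSpace S₂]
    [MeasurableSpace.CountablyGenerated S₀] [MeasurableEq S₀]
    [MeasurableSpace Y₁] [StandardBorelSpace Y₁] [MeasurableSpace Y₂] [StandardBorelSpace Y₂]
    [Nonempty Y₁] [Nonempty Y₂]
    {e₁ : S₁ → Y₁} {e₂ : S₂ → Y₂} (he₁ : IsUniversalEmbedding e₁) (he₂ : IsUniversalEmbedding e₂)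
    {h₁ : S₁ → S₀} {h₂ : S₂ → S₀} (hm₁ : Measurable h₁) (hm₂ : Measurable h₂)
    {α : Type*} [MeasurableSpace α] (κ₁ : Kernel α S₁) (κ₂ : Kernel α S₂)
    [IsFiniteKernel κ₁] [IsFiniteKernel κ₂] (h : κ₁.map h₁ = κ₂.map h₂) :
    ∃ η : Kernel α {p : S₁ × S₂ | h₁ p.1 = h₂ p.2},
      η.map (fun p => p.1.1) = κ₁ ∧ η.map (fun p => p.1.2) = κ₂ := by
  -- Pairing with `hᵢ` retains the `S₀`-coordinate, the common marginal over which to couple. `S₀`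
  -- itself need only be countably generated.
  have hg₁ := he₁.prodMk hm₁
  have hg₂ := he₂.prodMk hm₂
  have hE := (he₁.prodMap he₂).comp_subtype_val
    (measurableSet_eq_fun (hm₁.comp measurable_fst) (hm₂.comp measurable_snd))
  obtain ⟨κ, _, hκ₁, hκ₂⟩ := Kernel.exists_coupling_of_fst_eq
    (κ₁.map fun s => (h₁ s, e₁ s)) (κ₂.map fun s => (h₂ s, e₂ s)) (by
      rw [Kernel.fst_map_prod _ he₁.measurable, Kernel.fst_map_prod _ he₂.measurable, h])
  have hm₁' : Measurable (fun p : S₀ × Y₁ × Y₂ => (p.1, p.2.1)) := by fun_prop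
  have hm₂' : Measurable (fun p : S₀ × Y₁ × Y₂ => (p.1, p.2.2)) := by fun_prop
  have null₁ : ∀ a, κ a ((fun p => (p.1, p.2.1)) ⁻¹' (Set.range fun s => (h₁ s, e₁ s))ᶜ) = 0 := by
    intro a
    have := hg₁.map_compl_range (κ₁ a)
    rw [← Kernel.map_apply _ hg₁.measurable, ← hκ₁, Kernel.map_apply _ hm₁'] at this
    rwa [Measure.map_apply₀ hm₁'.aemeasurable (hg₁.range _ inferInstance).compl] at this
  have null₂ : ∀ a, κ a ((fun p => (p.1, p.2.2)) ⁻¹' (Set.range fun s => (h₂ s, e₂ s))ᶜ) = 0 := by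
    intro a
    have := hg₂.map_compl_range (κ₂ a)
    rw [← Kernel.map_apply _ hg₂.measurable, ← hκ₂, Kernel.map_apply _ hm₂'] at this
    rwa [Measure.map_apply₀ hm₂'.aemeasurable (hg₂.range _ inferInstance).compl] at this
  obtain ⟨η, hη⟩ := hE.exists_kernel_map_eq κ.snd (by
    intro a
    rw [Kernel.snd_apply, Measure.map_apply₀ measurable_snd.aemeasurable
      (hE.range _ inferInstance).compl]
    -- Off two null sets, `yᵢ = eᵢ sᵢ` with `hᵢ sᵢ = z` for both `i`; the shared `z` puts `(s₁, s₂)`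
    -- in the pullback.
    refine measure_mono_null ?_ (measure_union_null (null₁ a) (null₂ a))
    rintro ⟨z, y₁, y₂⟩ hp
    by_contra hn
    simp only [mem_union, mem_preimage, mem_compl_iff, not_or, not_not] at hn
    obtain ⟨⟨s₁, hs₁⟩, ⟨s₂, hs₂⟩⟩ := hn
    simp only [Prod.mk.injEq] at hs₁ hs₂
    exact hp ⟨⟨(s₁, s₂), hs₁.1.trans hs₂.1.symm⟩, Prod.ext hs₁.2 hs₂.2⟩)
  have hκ₁' : κ.snd.map Prod.fst = κ₁.map e₁ := by
    rw [← Kernel.snd_map_prod κ₁ hm₁, ← hκ₁, Kernel.snd_eq, Kernel.snd_eq,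
      ← Kernel.map_comp_right _ (by fun_prop) (by fun_prop),
      ← Kernel.map_comp_right _ (by fun_prop) (by fun_prop)]
    rfl
  have hκ₂' : κ.snd.map Prod.snd = κ₂.map e₂ := by
    rw [← Kernel.snd_map_prod κ₂ hm₂, ← hκ₂, Kernel.snd_eq, Kernel.snd_eq,
      ← Kernel.map_comp_right _ (by fun_prop) (by fun_prop),
      ← Kernel.map_comp_right _ (by fun_prop) (by fun_prop)]
    rfl
  refine ⟨η, ?_, ?_⟩
  · ext a Q hQ
    obtain ⟨B, hB, rfl⟩ := he₁.exists_preimage_eq hQ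
    rw [Kernel.map_apply' _ (by fun_prop) _ hQ, ← Kernel.map_apply' _ he₁.measurable _ hB, ← hκ₁',
      ← hη, Kernel.map_apply' _ measurable_fst _ hB,
      Kernel.map_apply' _ hE.measurable _ (measurable_fst hB)]
    rfl
  · ext a Q hQ
    obtain ⟨B, hB, rfl⟩ := he₂.exists_preimage_eq hQ
    rw [Kernel.map_apply' _ (by fun_prop) _ hQ, ← Kernel.map_apply' _ he₂.measurable _ hB, ← hκ₂',
      ← hη, Kernel.map_apply' _ measurable_snd _ hB,
      Kernel.map_apply' _ hE.measurable _ (measurable_snd hB)]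
    rfl

/-! ### The semipullback. -/

theorem IsSeparableUniversallyMeasurableSpace.exists_isUniversalEmbedding {S : Type u}
    [MeasurableSpace S] (hS : IsSeparableUniversallyMeasurableSpace S) :
    ∃ (Y : Type u) (_ : TopologicalSpace Y) (_ : PolishSpace Y) (_ : MeasurableSpace Y)
      (_ : BorelSpace Y) (e : S → Y), IsUniversalEmbedding e := by
  obtain ⟨Y, tY, pY, mY, bY, A, hA, ⟨e⟩⟩ := hS
  exact ⟨Y, tY, pY, mY, bY, _, e.isUniversalEmbedding_subtype_val hA⟩

theorem IsUniversalEmbedding.isSeparableUniversallyMeasurableSpace {S Y : Type u}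
    [MeasurableSpace S] [tY : TopologicalSpace Y] [pY : PolishSpace Y] [mY : MeasurableSpace Y]
    [bY : BorelSpace Y] {e : S → Y} (he : IsUniversalEmbedding e) :
    IsSeparableUniversallyMeasurableSpace S := by
  refine ⟨Y, tY, pY, mY, bY, Set.range e, he.range,
    ⟨⟨Equiv.ofInjective e he.injective, he.measurable.subtype_mk, ?_⟩⟩⟩
  intro Q hQ
  obtain ⟨B, hB, rfl⟩ := he.exists_preimage_eq hQ
  refine ⟨B, hB, ?_⟩
  ext ⟨_, s, rfl⟩
  simp [Equiv.ofInjective_symm_apply]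

/-- In the category of LMP over separable universally measurable spaces, with zigzag morphisms,
every cospan has a semipullback, i.e. can be completed to a commutative square. -/
theorem mainTheorem3 (L : Type v) (S₀ S₁ S₂ : UnivMeasLMP.{u, v} L)
    (h₁ : S₁ ⟶ S₀) (h₂ : S₂ ⟶ S₀) :
    ∃ (S₃ : UnivMeasLMP.{u, v} L) (k₁ : S₃ ⟶ S₁) (k₂ : S₃ ⟶ S₂), k₁ ≫ h₁ = k₂ ≫ h₂ := by
  let f₁ : LMP.Zigzag S₁.obj S₀.obj := h₁.hom
  let f₂ : LMP.Zigzag S₂.obj S₀.obj := h₂.hom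
  obtain ⟨Y₀, _, _, _, _, e₀, he₀⟩ := S₀.property.exists_isUniversalEmbedding
  obtain ⟨Y₁, _, _, _, _, e₁, he₁⟩ := S₁.property.exists_isUniversalEmbedding
  obtain ⟨Y₂, _, _, _, _, e₂, he₂⟩ := S₂.property.exists_isUniversalEmbedding
  have : MeasurableEq S₀.obj.State :=
    MeasurableEq.of_measurable_injective he₀.measurable he₀.injective
  have : MeasurableSpace.CountablyGenerated S₀.obj.State := by
    rw [← he₀.comap_eq]
    exact .comap _
  let P : Set (S₁.obj.State × S₂.obj.State) := {p | f₁.toFun p.1 = f₂.toFun p.2}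
  have hP : MeasurableSet P := measurableSet_eq_fun (f₁.measurable.comp measurable_fst)
    (f₂.measurable.comp measurable_snd)
  have hfin₁ : ∀ a, IsFiniteKernel (S₁.obj.τ a) := fun a => ⟨1, by simp, S₁.obj.τ_le_one a⟩
  have hfin₂ : ∀ a, IsFiniteKernel (S₂.obj.τ a) := fun a => ⟨1, by simp, S₂.obj.τ_le_one a⟩
  have hη : ∀ a, ∃ η : Kernel P P,
      η.map (fun p => p.1.1) = (S₁.obj.τ a).comap (fun p : P => p.1.1) (by fun_prop) ∧
      η.map (fun p => p.1.2) = (S₂.obj.τ a).comap (fun p : P => p.1.2) (by fun_prop) := by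
    intro a
    rcases isEmpty_or_nonempty P with hempty | ⟨⟨p, hp⟩⟩
    -- Disintegration needs `Y₁` and `Y₂` nonempty, so an empty `P` is treated apart.
    · exact ⟨0, by ext s; exact hempty.elim s, by ext s; exact hempty.elim s⟩
    have : Nonempty Y₁ := ⟨e₁ p.1⟩
    have : Nonempty Y₂ := ⟨e₂ p.2⟩
    refine exists_kernel_pullback he₁ he₂ f₁.measurable f₂.measurable _ _ ?_
    -- By the zigzag identities both images equal the transition measure of `S₀` at the common point
    -- `f₁ q.1 = f₂ q.2`.
    ext ⟨q, hq : f₁.toFun q.1 = f₂.toFun q.2⟩ Q hQ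
    rw [Kernel.map_apply' _ f₁.measurable _ hQ, Kernel.map_apply' _ f₂.measurable _ hQ,
      Kernel.comap_apply, Kernel.comap_apply, f₁.zigzag a _ Q hQ, f₂.zigzag a _ Q hQ, hq]
  choose η hη₁ hη₂ using hη
  have hz₁ : ∀ a (s : P) Q, MeasurableSet Q →
      η a s ((fun p : P => p.1.1) ⁻¹' Q) = S₁.obj.τ a s.1.1 Q := by
    intro a s Q hQ
    rw [← Kernel.map_apply' _ (by fun_prop) _ hQ, hη₁, Kernel.comap_apply]
  have hz₂ : ∀ a (s : P) Q, MeasurableSet Q →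
      η a s ((fun p : P => p.1.2) ⁻¹' Q) = S₂.obj.τ a s.1.2 Q := by
    intro a s Q hQ
    rw [← Kernel.map_apply' _ (by fun_prop) _ hQ, hη₂, Kernel.comap_apply]
  let T : LMP.{u, v} L :=
    { State := P
      τ := η
      τ_le_one := fun a s => (hz₁ a s Set.univ .univ).trans_le (S₁.obj.τ_le_one a s.1.1) }
  let k₁ : LMP.Zigzag T S₁.obj :=
    { toFun := fun p => p.1.1
      measurable := measurable_fst.comp measurable_subtype_coe
      surjective := fun x =>
        let ⟨y, hy⟩ := f₂.surjective (f₁.toFun x)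
        ⟨⟨(x, y), hy.symm⟩, rfl⟩
      zigzag := hz₁ }
  let k₂ : LMP.Zigzag T S₂.obj :=
    { toFun := fun p => p.1.2
      measurable := measurable_snd.comp measurable_subtype_coe
      surjective := fun y =>
        let ⟨x, hx⟩ := f₁.surjective (f₂.toFun y)
        ⟨⟨(x, y), hx⟩, rfl⟩
      zigzag := hz₂ }
  refine ⟨⟨T, ((he₁.prodMap he₂).comp_subtype_val hP).isSeparableUniversallyMeasurableSpace⟩,
    ⟨k₁⟩, ⟨k₂⟩, ?_⟩
  apply InducedCategory.Hom.ext
  apply LMP.Zigzag.ext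
  funext p
  exact p.2
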